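/- Let $r\ge 1$ be an integer, let $\Gamma$ be a free group of rank $r$ with free generating set $\{a_1,\dots,a_r\}$, let $S=\{a_1^{\pm1},\dots,a_r^{\pm1}\}$ and let $q=2r-1$. For an integer $n\ge 0$ let $S_n$, respectively $B_n$, be the sphere, respectively the closed ball, of radius $n$ around the identity $e\in\Gamma$ with respect to the word metric on $\Gamma$ defined by $S$. For a non-empty finite set $E\subset\Gamma$ put $\mu_E=\frac1{|E|}\sum_{\gamma\in E}\gamma\in\mathbb C[\Gamma]$. Let $\rho_\Gamma:\Gamma\to U(\ell^2(\Gamma))$, $(\rho_\Gamma(\gamma)f)(x)=f(x\gamma)$, be the right regular representation on the Hilbert space $\ell^2(\Gamma)$ of square summable complex functions on $\Gamma$. Denote also by $\rho_\Gamma$ its extension to a homomorphism of unital algebras from $\mathbb C[\Gamma]$ to the bounded operators on $\ell^2(\Gamma)$, and let $\|\cdot\|$ be the operator norm. Then, for every integer $n\ge 0$, \[ \|\rho_\Gamma(\mu_{S_n})\|=\left(1+\frac{q-1}{q+1}\,n\right)q^{-n/2} \] and \[ \|\rho_\Gamma(\mu_{B_n})\|=c(q,n)\left(1+\left(1+\frac1{\sqrt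 q}\right)n\right)q^{-n/2}, \qquad\text{where } c(q,n)=\left(1+2q^{-n}\sum_{k=0}^{n-1}q^k\right)^{-1}. \] -/

import Mathlib

noncomputable section

namespace FreeGroupNorm

/-! ### The word metric of a group with respect to a finite set -/

section WordMetric

variable {Γ : Type*} [Group Γ]

/-- The word length of `g` with respect to `S`: the least length of a word in the letters `S`
whose product is `g` (and `⊤` if there is no such word). For a symmetric generating set `S` this
is the usual word length. -/
def wordLength (S : Set Γ) (g : Γ) : ℕ∞ :=
  ⨅ (l : List Γ) (_ : (∀ s ∈ l, s ∈ S) ∧ l.prod = g), (l.length : ℕ∞)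

/-- The (left-invariant) word metric `d(x, y) = |x⁻¹ y|` defined by `S`. -/
def wordDist (S : Set Γ) (x y : Γ) : ℕ∞ :=
  wordLength S (x⁻¹ * y)

theorem finite_setOf_wordDist_le (S : Set Γ) [Finite S] (n : ℕ) :
    {g : Γ | wordDist S 1 g ≤ n}.Finite := by
  have hfin : {l : List S | l.length ≤ n}.Finite := List.finite_length_le S n
  refine (hfin.image fun l => (l.map Subtype.val).prod).subset ?_
  intro g hg
  have hlt : wordLength S g < ((n + 1 : ℕ) : ℕ∞) := by
    have h1 : wordLength S g ≤ n := by simpa [wordDist] using hg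
    exact lt_of_le_of_lt h1 (by exact_mod_cast Nat.lt_succ_self n)
  simp only [wordLength, iInf_lt_iff] at hlt
  obtain ⟨l, ⟨hl, hprod⟩, hlen⟩ := hlt
  have hlen' : l.length ≤ n := Nat.lt_succ_iff.mp (by exact_mod_cast hlen)
  refine ⟨l.attachWith (· ∈ S) hl, ?_, ?_⟩
  · simpa using hlen'
  · simpa using hprod

theorem finite_setOf_wordDist_eq (S : Set Γ) [Finite S] (n : ℕ) :
    {g : Γ | wordDist S 1 g = n}.Finite :=
  (finite_setOf_wordDist_le S n).subset fun _ hg => le_of_eq hg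

/-- The sphere of radius `n` around the identity for the word metric defined by `S`. -/
def wordSphere (S : Set Γ) [Finite S] (n : ℕ) : Finset Γ :=
  (finite_setOf_wordDist_eq S n).toFinset

/-- The closed ball of radius `n` around the identity for the word metric defined by `S`. -/
def wordBall (S : Set Γ) [Finite S] (n : ℕ) : Finset Γ :=
  (finite_setOf_wordDist_le S n).toFinset

/-- The set `{a₁^{±1}, …, a_r^{±1}}`. -/
abbrev symmetricSet {r : ℕ} (a : Fin r → Γ) : Set Γ :=
  Set.range a ∪ Set.range fun i => (a i)⁻¹

/-- The element `μ_E = |E|⁻¹ ∑_{γ ∈ E} γ` of the group algebra `ℂ[Γ]`. -/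
def mu (E : Finset Γ) : MonoidAlgebra ℂ Γ :=
  ((E.card : ℂ)⁻¹) • ∑ γ ∈ E, MonoidAlgebra.of ℂ Γ γ

end WordMetric

/-! ### Unitary representations and the right regular representation -/

section Representation

/-- The extension of a unitary representation of `Γ` on a Hilbert space `H` to a morphism of unital
algebras from the group algebra `ℂ[Γ]` to the bounded operators on `H`. -/
def extendRep {Γ : Type*} [Group Γ] {H : Type*} [NormedAddCommGroup H] [InnerProductSpace ℂ H]
    [CompleteSpace H] (π : Γ →* unitary (H →L[ℂ] H)) : MonoidAlgebra ℂ Γ →ₐ[ℂ] (H →L[ℂ] H) :=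
  MonoidAlgebra.lift ℂ (H →L[ℂ] H) Γ ((unitary (H →L[ℂ] H)).subtype.comp π)

variable (Γ : Type*)

/-- The Hilbert space `ℓ²(Γ)` of square summable complex functions on `Γ`. -/
abbrev L2 : Type _ := lp (fun _ : Γ => ℂ) 2

variable {Γ} in
/-- A permutation `σ` of the index set acts isometrically on `ℓ²` by `f ↦ f ∘ σ`. -/
def compPerm (σ : Equiv.Perm Γ) : L2 Γ ≃ₗᵢ[ℂ] L2 Γ where
  toFun f := ⟨fun x => f (σ x), by
    have h := (memℓp_gen_iff (p := 2) (by norm_num)).1 (lp.memℓp f)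
    exact memℓp_gen ((Equiv.summable_iff σ).2 h)⟩
  invFun f := ⟨fun x => f (σ.symm x), by
    have h := (memℓp_gen_iff (p := 2) (by norm_num)).1 (lp.memℓp f)
    exact memℓp_gen ((Equiv.summable_iff σ.symm).2 h)⟩
  map_add' f g := by ext x; rfl
  map_smul' c f := by ext x; rfl
  left_inv f := by
    ext x
    change f (σ (σ.symm x)) = f x
    simp
  right_inv f := by
    ext x
    change f (σ.symm (σ x)) = f x
    simp
  norm_map' f := by
    rw [lp.norm_eq_tsum_rpow (by norm_num), lp.norm_eq_tsum_rpow (by norm_num)]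
    congr 1
    exact Equiv.tsum_eq σ fun x => ‖f x‖ ^ (2 : ENNReal).toReal

variable [Group Γ]

/-- The right regular representation `ρ_Γ : Γ → U(ℓ²(Γ))`, `(ρ_Γ(γ) f)(x) = f(x γ)`. -/
def rho : Γ →* unitary (L2 Γ →L[ℂ] L2 Γ) :=
  Unitary.linearIsometryEquiv.symm.toMonoidHom.comp
    { toFun := fun γ => compPerm (Equiv.mulRight γ)
      map_one' := by
        ext f x
        change f (x * 1) = f x
        simp
      map_mul' := fun γ δ => by
        ext f x
        change f (x * (γ * δ)) = f (x * γ * δ)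
        rw [mul_assoc] }

theorem rho_apply (γ : Γ) (f : L2 Γ) (x : Γ) :
    ((rho Γ γ : L2 Γ →L[ℂ] L2 Γ) f) x = f (x * γ) := rfl

end Representation

/-- The constant `c(q, n) = (1 + 2 q^{-n} ∑_{k=0}^{n-1} q^k)⁻¹`. -/
def c (q : ℝ) (n : ℕ) : ℝ :=
  (1 + 2 * q ^ (-(n : ℤ)) * ∑ k ∈ Finset.range n, q ^ k)⁻¹

end FreeGroupNorm

end

/-! The norms are computed from a single function, the spherical function
`φ(x) = (1 + (q - 1) / (q + 1) * |x|) * q ^ (-|x| / 2)` on the free group (`spherical`). In the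
Cayley tree every vertex other than the identity has one neighbour closer to the identity and `q`
farther away (`exists_len_mul_letter`), so `φ` is a positive eigenfunction of the summation over
the generators, for the eigenvalue `2 * √q` (`sum_spherical_letter`). The summations `T_n` over
spheres satisfy `T_1 ∘ T_1 = T_2 + (q + 1)` and `T_1 ∘ T_n = T_(n+1) + q * T_(n-1)` for `n ≥ 2`, so
`φ` is an eigenfunction of all of them, and hence also of the summations over balls
(`sum_wordSphere_of_eigen`). The eigenvalue for `T_n` is `|S_n| * φ(n)`. The same recurrence
applied to the constant function `1` gives the cardinality of `S_n`.

It remains to see that the norm on `ℓ²` of such an operator `T` is its eigenvalue `Λ` on `φ`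
(`norm_extendRep_sum_eq`). The Schur test with the positive weight `φ` gives `‖T‖ ≤ Λ`
(`norm_extendRep_sum_le`). Conversely, let `u m` be the sum of `φ ^ 2` over the ball of radius `m`.
Testing `T` on the restriction of `φ` to the ball of radius `m + n` gives
`Λ ^ 2 * u m ≤ ‖T‖ ^ 2 * u (m + n)` (`sq_mul_sum_le_norm_sq_mul_sum`). If `‖T‖ < Λ`, then `u` would
grow exponentially, whereas `u m` is at most `2 * (m + 1) ^ 3`. -/

namespace FreeGroupNorm

/-! ### Word length in a free group -/

section Length

variable {ι Γ : Type*} [Group Γ] (a : FreeGroupBasis ι Γ)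

/-- The letter `a i` or `(a i)⁻¹`, according to the Boolean. -/
def letter (p : ι × Bool) : Γ := cond p.2 (a p.1) (a p.1)⁻¹

theorem letter_not (i : ι) (b : Bool) : letter a (i, !b) = (letter a (i, b))⁻¹ := by
  cases b <;> simp [letter]

theorem repr_letter (p : ι × Bool) : a.repr (letter a p) = FreeGroup.mk [p] := by
  rcases p with ⟨i, _ | _⟩ <;> simp [letter, FreeGroup.of, FreeGroup.invRev]

variable [DecidableEq ι]

/-- The length of the reduced word representing `g` in the basis `a`. -/
def len (g : Γ) : ℕ := (a.repr g).norm

theorem len_one : len a 1 = 0 := by simp [len]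

theorem len_eq_zero {g : Γ} : len a g = 0 ↔ g = 1 := by simp [len]

theorem len_inv (g : Γ) : len a g⁻¹ = len a g := by simp [len]

theorem len_mul_le (g h : Γ) : len a (g * h) ≤ len a g + len a h := by
  simpa [len] using FreeGroup.norm_mul_le _ _

theorem len_letter (p : ι × Bool) : len a (letter a p) = 1 := by
  simp [len, repr_letter, FreeGroup.norm]

theorem exists_len_letter_mul {g : Γ} (hg : g ≠ 1) :
    ∃ p₀, len a (letter a p₀ * g) + 1 = len a g ∧
      ∀ p ≠ p₀, len a (letter a p * g) = len a g + 1 := by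
  have hmul : ∀ p, len a (letter a p * g) =
      (FreeGroup.reduce (p :: (a.repr g).toWord)).length := by
    intro p
    simp [len, repr_letter, FreeGroup.norm, FreeGroup.toWord_mul]
  have hne : (a.repr g).toWord ≠ [] := by simpa using hg
  obtain ⟨⟨i, b⟩, t, ht⟩ := List.exists_cons_of_ne_nil hne
  have hlen : len a g = t.length + 1 := by simp [len, FreeGroup.norm, ht]
  have hred : FreeGroup.reduce ((i, b) :: t) = (i, b) :: t := by
    rw [← ht, FreeGroup.reduce_toWord]
  -- the letter that cancels the first letter of the reduced word
  refine ⟨(i, !b), ?_, ?_⟩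
  · rw [hmul, hlen, ht, FreeGroup.reduce.cons, hred]
    simp
  · intro p hp
    rw [hmul, hlen, ht, FreeGroup.reduce.cons, hred]
    have : ¬ (p.1 = i ∧ p.2 = !b) := fun h => hp (Prod.ext h.1 h.2)
    simp [this]

/-- Every vertex of the Cayley tree other than the identity has a unique neighbour closer to the
identity, and all its other neighbours are farther away. -/
theorem exists_len_mul_letter {g : Γ} (hg : g ≠ 1) :
    ∃ p₀, len a (g * letter a p₀) + 1 = len a g ∧
      ∀ p ≠ p₀, len a (g * letter a p) = len a g + 1 := by
  obtain ⟨⟨i, b⟩, h₀, h₁⟩ := exists_len_letter_mul a (g := g⁻¹) (by simpa using hg)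
  have key : ∀ j c, len a (g * letter a (j, c)) = len a (letter a (j, !c) * g⁻¹) := by
    intro j c
    rw [letter_not, ← mul_inv_rev, len_inv]
  refine ⟨(i, !b), ?_, ?_⟩
  · rw [key, Bool.not_not, h₀, len_inv]
  · rintro ⟨j, c⟩ hp
    rw [key, h₁, len_inv]
    rintro h
    apply hp
    simp only [Prod.mk.injEq] at h ⊢
    exact ⟨h.1, by rw [← h.2, Bool.not_not]⟩

theorem sum_len_mul_letter [Fintype ι] (F : ℕ → ℝ) {g : Γ} (hg : g ≠ 1) :
    ∑ p, F (len a (g * letter a p)) =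
      (2 * (Fintype.card ι : ℝ) - 1) * F (len a g + 1) + F (len a g - 1) := by
  obtain ⟨p₀, h₀, h₁⟩ := exists_len_mul_letter a hg
  rw [Fintype.sum_eq_add_sum_compl p₀,
    Finset.sum_congr rfl (g := fun _ => F (len a g + 1))
      (fun p hp => by rw [h₁ p (by simpa using hp)]),
    Finset.sum_const, Finset.card_compl, ← h₀]
  have hcard : 1 ≤ Fintype.card (ι × Bool) := Fintype.card_pos_iff.2 ⟨p₀⟩
  rw [Finset.card_singleton, nsmul_eq_mul, Nat.cast_sub hcard]
  simp only [Fintype.card_prod, Fintype.card_bool, Nat.add_sub_cancel]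
  push_cast
  ring

theorem sum_len_letter [Fintype ι] (F : ℕ → ℝ) :
    ∑ p, F (len a (letter a p)) = 2 * (Fintype.card ι : ℝ) * F 1 := by
  simp [len_letter, mul_comm]

/-- A group element is a product of as many letters as its length. -/
theorem exists_letters (n : ℕ) : ∀ g : Γ, len a g = n →
    ∃ l : List Γ, (∀ s ∈ l, ∃ p, s = letter a p) ∧ l.prod = g ∧ l.length = n := by
  induction n with
  | zero => exact fun g hg => ⟨[], by simp, by simp [(len_eq_zero a).1 hg], rfl⟩
  | succ n ih =>
    intro g hg
    have hg1 : g ≠ 1 := by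
      rintro rfl
      simp [len_one] at hg
    obtain ⟨⟨i, b⟩, h₀, -⟩ := exists_len_letter_mul a hg1
    obtain ⟨l, hl, hprod, hlen⟩ := ih (letter a (i, b) * g) (by omega)
    refine ⟨letter a (i, !b) :: l, ?_, ?_, by simp [hlen]⟩
    · simp only [List.mem_cons, forall_eq_or_imp]
      exact ⟨⟨_, rfl⟩, hl⟩
    · rw [List.prod_cons, hprod, letter_not, inv_mul_cancel_left]

theorem len_prod_le : ∀ l : List Γ, (∀ s ∈ l, ∃ p, s = letter a p) → len a l.prod ≤ l.length
  | [], _ => by simp [len_one]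
  | s :: l, h => by
    obtain ⟨p, rfl⟩ := h s (by simp)
    have h₁ := len_mul_le a (letter a p) l.prod
    have h₂ := len_prod_le l fun t ht => h t (by simp [ht])
    rw [len_letter] at h₁
    rw [List.prod_cons, List.length_cons]
    omega

end Length

section Spheres

variable {r : ℕ} {Γ : Type*} [Group Γ] (a : FreeGroupBasis (Fin r) Γ)

theorem mem_symmetricSet_iff (g : Γ) : g ∈ symmetricSet a ↔ ∃ p, g = letter a p := by
  constructor
  · rintro (⟨i, rfl⟩ | ⟨i, rfl⟩)
    · exact ⟨(i, true), rfl⟩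
    · exact ⟨(i, false), rfl⟩
  · rintro ⟨⟨i, _ | _⟩, rfl⟩
    · exact Or.inr ⟨i, rfl⟩
    · exact Or.inl ⟨i, rfl⟩

theorem wordDist_one (g : Γ) : wordDist (symmetricSet a) 1 g = len a g := by
  simp only [wordDist, wordLength, inv_one, one_mul, mem_symmetricSet_iff]
  apply le_antisymm
  · obtain ⟨l, hl, hprod, hlen⟩ := exists_letters a _ g rfl
    exact iInf₂_le_of_le l ⟨hl, hprod⟩ (by rw [hlen])
  · refine le_iInf₂ fun l hl => ?_
    rw [← hl.2]
    exact_mod_cast len_prod_le a l hl.1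

theorem mem_wordSphere {n : ℕ} {g : Γ} : g ∈ wordSphere (symmetricSet a) n ↔ len a g = n := by
  simp [wordSphere, wordDist_one]

theorem mem_wordBall {n : ℕ} {g : Γ} : g ∈ wordBall (symmetricSet a) n ↔ len a g ≤ n := by
  simp [wordBall, wordDist_one]

theorem sum_wordBall_succ (n : ℕ) (f : Γ → ℝ) :
    ∑ g ∈ wordBall (symmetricSet a) (n + 1), f g =
      ∑ g ∈ wordBall (symmetricSet a) n, f g + ∑ g ∈ wordSphere (symmetricSet a) (n + 1), f g := by
  classical
  rw [← Finset.sum_union]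
  · congr 1
    ext g
    simp only [Finset.mem_union, mem_wordBall, mem_wordSphere]
    omega
  · rw [Finset.disjoint_left]
    intro g
    simp only [mem_wordBall, mem_wordSphere]
    omega

theorem sum_wordBall_zero (f : Γ → ℝ) : ∑ g ∈ wordBall (symmetricSet a) 0, f g = f 1 := by
  have : wordBall (symmetricSet a) 0 = {1} := by
    ext g
    simp [mem_wordBall, len_eq_zero]
  simp [this]

theorem sum_wordSphere_zero (f : Γ → ℝ) : ∑ g ∈ wordSphere (symmetricSet a) 0, f g = f 1 := by
  have : wordSphere (symmetricSet a) 0 = {1} := by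
    ext g
    simp [mem_wordSphere, len_eq_zero]
  simp [this]

theorem sum_wordBall_eq_sum (n : ℕ) (f : Γ → ℝ) :
    ∑ g ∈ wordBall (symmetricSet a) n, f g =
      ∑ k ∈ Finset.range (n + 1), ∑ g ∈ wordSphere (symmetricSet a) k, f g := by
  induction n with
  | zero => simp [sum_wordBall_zero, sum_wordSphere_zero]
  | succ n ih => rw [sum_wordBall_succ, ih, Finset.sum_range_succ _ (n + 1)]

/-- Each element `h` is counted once for every letter `p` for which `h p⁻¹` lies on the sphere. -/
theorem sum_sphere_sum_letter (n : ℕ) (f : Γ → ℝ) :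
    ∑ g ∈ wordSphere (symmetricSet a) n, ∑ p, f (g * letter a p) =
      ∑ h ∈ wordBall (symmetricSet a) (n + 1),
        (∑ p, if len a (h * letter a p) = n then (1 : ℝ) else 0) * f h := by
  classical
  -- the set of letters is closed under inversion
  have hinv : ∀ h : Γ, (∑ p, if len a (h * letter a p) = n then (1 : ℝ) else 0) =
      ∑ p, if len a (h * (letter a p)⁻¹) = n then (1 : ℝ) else 0 := by
    intro h
    refine Fintype.sum_equiv ((Equiv.refl (Fin r)).prodCongr Equiv.boolNot) _ _ ?_
    rintro ⟨i, b⟩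
    simp [letter_not]
  simp only [hinv, Finset.sum_mul, ite_mul, one_mul, zero_mul]
  rw [Finset.sum_comm, Finset.sum_comm (s := wordBall (symmetricSet a) (n + 1))]
  refine Finset.sum_congr rfl fun p _ => ?_
  rw [← Finset.sum_filter]
  refine Finset.sum_nbij' (fun g => g * letter a p) (fun h => h * (letter a p)⁻¹) ?_ ?_ ?_ ?_ ?_
  · intro g hg
    have hg' := (mem_wordSphere a).1 hg
    have := len_mul_le a g (letter a p)
    rw [len_letter] at this
    rw [Finset.mem_filter, mem_wordBall, mul_inv_cancel_right]
    exact ⟨by omega, hg'⟩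
  · intro h hh
    rw [Finset.mem_filter] at hh
    exact (mem_wordSphere a).2 hh.2
  · intro g _
    exact mul_inv_cancel_right _ _
  · intro g _
    exact inv_mul_cancel_right _ _
  · intro g _
    rfl

/-- Multiplying an element of the unit sphere by a letter either gives an element of the sphere of
radius `2`, in a unique way, or gives the identity, once for each of the `2 * r` letters. -/
theorem sum_sphere_one_sum_letter (f : Γ → ℝ) :
    ∑ g ∈ wordSphere (symmetricSet a) 1, ∑ p, f (g * letter a p) =
      ∑ g ∈ wordSphere (symmetricSet a) 2, f g + 2 * (r : ℝ) * f 1 := by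
  have h1 : ∀ h : Γ, len a h ≠ 0 → (∑ p, if len a (h * letter a p) = 1 then (1 : ℝ) else 0) =
      if len a h = 2 then 1 else 0 := by
    intro h hh
    rw [sum_len_mul_letter a (fun k => if k = 1 then (1 : ℝ) else 0)
      (fun h1 => hh ((len_eq_zero a).2 h1))]
    rw [if_neg (by omega), mul_zero, zero_add]
    exact if_congr (by omega) rfl rfl
  rw [sum_sphere_sum_letter, sum_wordBall_succ, sum_wordBall_succ, sum_wordBall_zero,
    Finset.sum_eq_zero (s := wordSphere _ (0 + 1)), Finset.sum_congr rfl (g := f)]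
  · have := sum_len_letter a (fun k => if k = 1 then (1 : ℝ) else 0)
    simp only [one_mul, this]
    simp
    ring
  · intro h hh
    rw [mem_wordSphere] at hh
    rw [h1 h (by omega), if_pos (by omega), one_mul]
  · intro h hh
    rw [mem_wordSphere] at hh
    rw [h1 h (by omega), if_neg (by omega), zero_mul]

/-- An element `h` of length `n + 3` arises as `g * letter a p` with `g` of length `n + 2` in one way
only, an element of length `n + 1` in `2 * r - 1` ways. The identity, which has `2 * r` neighbours
instead, has length less than `n + 1`; hence the separate statement for radius `1`. -/
theorem sum_sphere_add_two_sum_letter (n : ℕ) (f : Γ → ℝ) :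
    ∑ g ∈ wordSphere (symmetricSet a) (n + 2), ∑ p, f (g * letter a p) =
      ∑ g ∈ wordSphere (symmetricSet a) (n + 3), f g +
        (2 * (r : ℝ) - 1) * ∑ g ∈ wordSphere (symmetricSet a) (n + 1), f g := by
  have h1 : ∀ h : Γ, (∑ p, if len a (h * letter a p) = n + 2 then (1 : ℝ) else 0) =
      (if len a h = n + 3 then 1 else 0) +
        (2 * (r : ℝ) - 1) * if len a h = n + 1 then 1 else 0 := by
    intro h
    by_cases hh : h = 1
    · subst hh
      simp [len_letter, len_one]
    · have h0 : len a h ≠ 0 := fun h1 => hh ((len_eq_zero a).1 h1)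
      rw [sum_len_mul_letter a (fun k => if k = n + 2 then (1 : ℝ) else 0) hh, Fintype.card_fin,
        add_comm]
      congr 1
      · exact if_congr (by omega) rfl rfl
      · congr 1
        exact if_congr (by omega) rfl rfl
  have hsub : ∀ k ≤ n + 3,
      ∑ h ∈ wordBall (symmetricSet a) (n + 2 + 1), (if len a h = k then (1 : ℝ) else 0) * f h =
        ∑ h ∈ wordSphere (symmetricSet a) k, f h := by
    intro k hk
    simp only [ite_mul, one_mul, zero_mul]
    rw [← Finset.sum_filter]
    congr 1
    ext h
    simp only [Finset.mem_filter, mem_wordBall, mem_wordSphere]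
    omega
  rw [sum_sphere_sum_letter]
  simp only [h1, add_mul, Finset.sum_add_distrib, mul_assoc, ← Finset.mul_sum]
  rw [hsub _ le_rfl, hsub _ (by omega)]

theorem sum_wordSphere_one (f : Γ → ℝ) :
    ∑ g ∈ wordSphere (symmetricSet a) 1, f g = ∑ p, f (letter a p) := by
  classical
  have h := sum_sphere_sum_letter a 0 f
  rw [sum_wordSphere_zero, sum_wordBall_succ, sum_wordBall_zero] at h
  simp only [one_mul, len_letter, one_ne_zero, if_false, Finset.sum_const_zero, zero_mul,
    zero_add] at h
  rw [h]
  refine Finset.sum_congr rfl fun g hg => ?_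
  rw [mem_wordSphere] at hg
  rw [sum_len_mul_letter a (fun k => if k = 0 then (1 : ℝ) else 0)
    (fun h1 => by simp [h1, len_one] at hg)]
  simp [hg]

/-- An eigenfunction of the summation over the generators is an eigenfunction of the summation over
every sphere, and the eigenvalues satisfy a three-term recurrence. -/
theorem sum_wordSphere_of_eigen {f : Γ → ℝ} {lam : ℝ}
    (hf : ∀ x, ∑ p, f (x * letter a p) = lam * f x) {P : ℕ → ℝ} (h0 : P 0 = 1) (h1 : P 1 = lam)
    (h2 : P 2 = lam * P 1 - 2 * (r : ℝ))
    (h3 : ∀ n, P (n + 3) = lam * P (n + 2) - (2 * (r : ℝ) - 1) * P (n + 1)) (x : Γ) :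
    ∀ n, ∑ g ∈ wordSphere (symmetricSet a) n, f (x * g) = P n * f x := by
  have hlam : ∀ n, ∑ g ∈ wordSphere (symmetricSet a) n, ∑ p, f (x * (g * letter a p)) =
      lam * ∑ g ∈ wordSphere (symmetricSet a) n, f (x * g) := by
    intro n
    rw [Finset.mul_sum]
    refine Finset.sum_congr rfl fun g _ => ?_
    simp only [← mul_assoc, hf]
  have e1 : ∑ g ∈ wordSphere (symmetricSet a) 1, f (x * g) = P 1 * f x := by
    rw [sum_wordSphere_one a (fun g => f (x * g)), hf, h1]
  have e2 : ∑ g ∈ wordSphere (symmetricSet a) 2, f (x * g) = P 2 * f x := by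
    have := sum_sphere_one_sum_letter a (fun g => f (x * g))
    rw [hlam, e1, mul_one] at this
    rw [h2]
    linarith
  have key : ∀ n, ∑ g ∈ wordSphere (symmetricSet a) (n + 1), f (x * g) = P (n + 1) * f x ∧
      ∑ g ∈ wordSphere (symmetricSet a) (n + 2), f (x * g) = P (n + 2) * f x := by
    intro n
    induction n with
    | zero => exact ⟨e1, e2⟩
    | succ n ih =>
      refine ⟨ih.2, ?_⟩
      have := sum_sphere_add_two_sum_letter a n (fun g => f (x * g))
      rw [hlam, ih.1, ih.2] at this
      change ∑ g ∈ wordSphere (symmetricSet a) (n + 3), f (x * g) = P (n + 3) * f x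
      rw [h3]
      linarith
  rintro (_ | n)
  · rw [sum_wordSphere_zero a (fun g => f (x * g)), mul_one, h0, one_mul]
  · exact (key n).1

end Spheres

/-! ### Norms of positive convolution operators -/

section Operators

theorem sum_norm_sq_le {Γ : Type*} (f : L2 Γ) (s : Finset Γ) :
    ∑ x ∈ s, ‖f x‖ ^ 2 ≤ ‖f‖ ^ 2 := by
  simpa using lp.sum_rpow_le_norm_rpow (p := 2) (by norm_num) f s

variable {Γ : Type*} [Group Γ]

theorem extendRep_rho_sum_apply (E : Finset Γ) (f : L2 Γ) (x : Γ) :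
    extendRep (rho Γ) (∑ γ ∈ E, MonoidAlgebra.of ℂ Γ γ) f x = ∑ γ ∈ E, f (x * γ) := by
  have h : extendRep (rho Γ) (∑ γ ∈ E, MonoidAlgebra.of ℂ Γ γ) =
      ∑ γ ∈ E, (rho Γ γ : L2 Γ →L[ℂ] L2 Γ) := by
    rw [map_sum]
    refine Finset.sum_congr rfl fun γ _ => ?_
    simp [extendRep, MonoidAlgebra.lift_single]
  rw [h, sum_apply, lp.coeFn_sum, Finset.sum_apply]
  exact Finset.sum_congr rfl fun γ _ => rho_apply Γ γ f x

theorem norm_extendRep_mu (E : Finset Γ) :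
    ‖extendRep (rho Γ) (mu E)‖ =
      (E.card : ℝ)⁻¹ * ‖extendRep (rho Γ) (∑ γ ∈ E, MonoidAlgebra.of ℂ Γ γ)‖ := by
  rw [mu, map_smul, norm_smul, norm_inv, Complex.norm_natCast]

variable {E : Finset Γ} {φ : Γ → ℝ} {Λ : ℝ}

/-- The Schur test: for a symmetric set `E`, a positive eigenfunction of `f ↦ ∑ γ ∈ E, f (· * γ)`,
square summable or not, bounds the norm of this operator on `ℓ²` by its eigenvalue. -/
theorem norm_extendRep_sum_le (hφ : ∀ x, 0 < φ x) (hE : ∀ γ ∈ E, γ⁻¹ ∈ E)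
    (hΛ : ∀ x, ∑ γ ∈ E, φ (x * γ) = Λ * φ x) :
    ‖extendRep (rho Γ) (∑ γ ∈ E, MonoidAlgebra.of ℂ Γ γ)‖ ≤ Λ := by
  classical
  have hΛ0 : 0 ≤ Λ := by
    refine nonneg_of_mul_nonneg_left ?_ (hφ 1)
    rw [← hΛ]
    exact Finset.sum_nonneg fun γ _ => (hφ _).le
  have hinv : ∀ y, ∑ γ ∈ E, φ (y * γ⁻¹) = Λ * φ y := by
    intro y
    rw [← hΛ]
    exact Finset.sum_nbij' (fun γ => γ⁻¹) (fun γ => γ⁻¹) hE hE (by simp) (by simp) (by simp)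
  refine ContinuousLinearMap.opNorm_le_bound _ hΛ0 fun f => ?_
  refine lp.norm_le_of_forall_sum_le (p := 2) (by norm_num) (by positivity) fun s => ?_
  simp only [ENNReal.toReal_ofNat, Real.rpow_ofNat, extendRep_rho_sum_apply]
  -- the Cauchy–Schwarz inequality with weights `φ (x * γ)`
  have hcs : ∀ x, ‖∑ γ ∈ E, f (x * γ)‖ ^ 2 ≤
      Λ * ∑ γ ∈ E, φ x * (‖f (x * γ)‖ ^ 2 / φ (x * γ)) := by
    intro x
    rcases E.eq_empty_or_nonempty with rfl | hne
    · simp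
    have h1 := Finset.sq_sum_div_le_sum_sq_div E (fun γ => ‖f (x * γ)‖)
      (g := fun γ => φ (x * γ)) (fun γ _ => hφ _)
    rw [div_le_iff₀ (Finset.sum_pos (fun γ _ => hφ _) hne), hΛ] at h1
    calc ‖∑ γ ∈ E, f (x * γ)‖ ^ 2 ≤ (∑ γ ∈ E, ‖f (x * γ)‖) ^ 2 := by
          gcongr
          exact norm_sum_le _ _
      _ ≤ _ := h1
      _ = _ := by
          rw [← Finset.mul_sum]
          ring
  -- a finite set containing all the points `x * γ`
  let F : Finset Γ := E.biUnion fun γ => s.image fun x => x * γ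
  have hF : ∀ γ ∈ E, ∑ x ∈ s, φ x * (‖f (x * γ)‖ ^ 2 / φ (x * γ)) ≤
      ∑ y ∈ F, φ (y * γ⁻¹) * (‖f y‖ ^ 2 / φ y) := by
    intro γ hγ
    calc ∑ x ∈ s, φ x * (‖f (x * γ)‖ ^ 2 / φ (x * γ))
        = ∑ y ∈ s.image fun x => x * γ, φ (y * γ⁻¹) * (‖f y‖ ^ 2 / φ y) := by
          rw [Finset.sum_image fun x _ y _ h => mul_right_cancel h]
          simp
      _ ≤ _ := by
          refine Finset.sum_le_sum_of_subset_of_nonneg ?_ fun y _ _ => ?_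
          · exact Finset.subset_biUnion_of_mem (fun γ => s.image fun x => x * γ) hγ
          · have := hφ y
            have := hφ (y * γ⁻¹)
            positivity
  calc ∑ x ∈ s, ‖∑ γ ∈ E, f (x * γ)‖ ^ 2
      ≤ ∑ x ∈ s, Λ * ∑ γ ∈ E, φ x * (‖f (x * γ)‖ ^ 2 / φ (x * γ)) :=
        Finset.sum_le_sum fun x _ => hcs x
    _ = Λ * ∑ γ ∈ E, ∑ x ∈ s, φ x * (‖f (x * γ)‖ ^ 2 / φ (x * γ)) := by
        rw [← Finset.mul_sum, Finset.sum_comm]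
    _ ≤ Λ * ∑ γ ∈ E, ∑ y ∈ F, φ (y * γ⁻¹) * (‖f y‖ ^ 2 / φ y) := by
        gcongr with γ hγ
        exact hF γ hγ
    _ = Λ * ∑ y ∈ F, Λ * ‖f y‖ ^ 2 := by
        rw [Finset.sum_comm]
        congr 1
        refine Finset.sum_congr rfl fun y _ => ?_
        rw [← Finset.sum_mul, hinv]
        have := (hφ y).ne'
        field_simp
    _ = Λ ^ 2 * ∑ y ∈ F, ‖f y‖ ^ 2 := by
        rw [← Finset.mul_sum]
        ring
    _ ≤ Λ ^ 2 * ‖f‖ ^ 2 := by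
        gcongr
        exact sum_norm_sq_le f F
    _ = (Λ * ‖f‖) ^ 2 := by ring

/-- Testing the operator on the restriction of an eigenfunction to the finite set `t`: the
eigenvalue equation survives at the points `x` with `x * E ⊆ t`. -/
theorem sq_mul_sum_le_norm_sq_mul_sum (hΛ : ∀ x, ∑ γ ∈ E, φ (x * γ) = Λ * φ x) {s t : Finset Γ}
    (hst : ∀ x ∈ s, ∀ γ ∈ E, x * γ ∈ t) :
    Λ ^ 2 * ∑ x ∈ s, φ x ^ 2 ≤
      ‖extendRep (rho Γ) (∑ γ ∈ E, MonoidAlgebra.of ℂ Γ γ)‖ ^ 2 * ∑ x ∈ t, φ x ^ 2 := by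
  classical
  set T := extendRep (rho Γ) (∑ γ ∈ E, MonoidAlgebra.of ℂ Γ γ)
  let f : L2 Γ := ∑ x ∈ t, lp.single 2 x (φ x : ℂ)
  have hf : ∀ x ∈ t, f x = φ x := by
    intro x hx
    simp only [f, lp.coeFn_sum, Finset.sum_apply, lp.single_apply]
    rw [Finset.sum_eq_single x]
    · simp
    · intro y _ hy
      simp [hy.symm]
    · exact fun h => (h hx).elim
  have hnorm : ‖f‖ ^ 2 = ∑ x ∈ t, φ x ^ 2 := by
    have := lp.norm_sum_single (p := 2) (E := fun _ : Γ => ℂ) (by norm_num)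
      (fun x => (φ x : ℂ)) t
    simpa using this
  have hT : ∀ x ∈ s, ‖T f x‖ ^ 2 = Λ ^ 2 * φ x ^ 2 := by
    intro x hx
    have : T f x = ((Λ * φ x : ℝ) : ℂ) := by
      rw [extendRep_rho_sum_apply, ← hΛ, Complex.ofReal_sum]
      exact Finset.sum_congr rfl fun γ hγ => hf _ (hst x hx γ hγ)
    rw [this, Complex.norm_real, Real.norm_eq_abs, sq_abs, mul_pow]
  calc Λ ^ 2 * ∑ x ∈ s, φ x ^ 2 = ∑ x ∈ s, ‖T f x‖ ^ 2 := by
        rw [Finset.mul_sum]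
        exact (Finset.sum_congr rfl hT).symm
    _ ≤ ‖T f‖ ^ 2 := sum_norm_sq_le _ _
    _ ≤ (‖T‖ * ‖f‖) ^ 2 := by
        gcongr
        exact T.le_opNorm f
    _ = _ := by rw [mul_pow, hnorm]

end Operators

/-- A sequence of polynomial growth cannot grow geometrically along an arithmetic progression. -/
theorem le_of_mul_le_mul_add_of_le_pow {u : ℕ → ℝ} {C L M : ℝ} {n d : ℕ} (hM : 0 ≤ M)
    (h0 : 0 < u 0) (hu : ∀ m, u m ≤ C * ((m : ℝ) + 1) ^ d)
    (h : ∀ m, L * u m ≤ M * u (m + n)) : L ≤ M := by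
  by_contra! hML
  have hL : 0 < L := hM.trans_lt hML
  have hM0 : 0 < M := by
    rcases hM.eq_or_lt with rfl | h'
    · have := h 0
      rw [zero_mul] at this
      exact absurd this (not_le.2 (mul_pos hL h0))
    · exact h'
  have hR : 1 < L / M := (one_lt_div hM0).2 hML
  have hpow : ∀ k : ℕ, (L / M) ^ k * u 0 ≤ u (k * n) := by
    intro k
    induction k with
    | zero => simp
    | succ k ih =>
      have := h (k * n)
      rw [← div_le_iff₀' hM0] at this
      calc (L / M) ^ (k + 1) * u 0 = L / M * ((L / M) ^ k * u 0) := by ring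
        _ ≤ L / M * u (k * n) := by gcongr
        _ = L * u (k * n) / M := by ring
        _ ≤ u (k * n + n) := this
        _ = u ((k + 1) * n) := by rw [add_mul, one_mul]
  have hC : 0 ≤ C := by
    have := hu 0
    norm_num at this
    linarith
  have hlim : Filter.Tendsto (fun k : ℕ => C * ((n : ℝ) + 1) ^ d * ((k : ℝ) ^ d / (L / M) ^ k))
      Filter.atTop (nhds (C * ((n : ℝ) + 1) ^ d * 0)) :=
    (tendsto_pow_const_div_const_pow_of_one_lt d hR).const_mul _
  rw [mul_zero] at hlim
  obtain ⟨k, hk, hk1⟩ := ((hlim.eventually_lt_const h0).and (Filter.eventually_ge_atTop 1)).exists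
  have hRk : 0 < (L / M) ^ k := by positivity
  have hk1' : (1 : ℝ) ≤ k := by exact_mod_cast hk1
  have h1 : (L / M) ^ k * u 0 ≤ C * (((n : ℝ) + 1) * k) ^ d := by
    refine (hpow k).trans ((hu _).trans ?_)
    gcongr
    push_cast
    linarith
  rw [mul_pow, ← mul_assoc, ← le_div_iff₀' hRk, mul_div_assoc] at h1
  linarith

/-! ### The spherical function at the top of the spectrum -/

/-- With `t = √q`, the radial eigenfunction `(1 + (q - 1) / (q + 1) * k) * q ^ (-k / 2)` of the sum
over the generators for the eigenvalue `2 * √q`, as a function of the length `k`. -/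
noncomputable def spherical (t : ℝ) (k : ℕ) : ℝ :=
  (1 + (t ^ 2 - 1) / (t ^ 2 + 1) * k) / t ^ k

/-- With `t = √q`, the number `(q + 1) * q ^ (n - 1)` of elements of the sphere of radius `n` in
the free group, with the value `1` at `n = 0`. -/
noncomputable def sphereCard (t : ℝ) (n : ℕ) : ℝ :=
  if n = 0 then 1 else (t ^ 2 + 1) * t ^ (2 * n) / t ^ 2

theorem spherical_pos {t : ℝ} (ht : 1 ≤ t) (k : ℕ) : 0 < spherical t k := by
  have h : 0 ≤ (t ^ 2 - 1) / (t ^ 2 + 1) :=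
    div_nonneg (sub_nonneg.2 (one_le_pow₀ ht)) (by positivity)
  unfold spherical
  positivity

theorem spherical_zero (t : ℝ) : spherical t 0 = 1 := by simp [spherical]

/-- The contribution of the sphere of radius `k` to the square sum of the spherical function is
polynomial in `k`: the exponential factors cancel. -/
theorem sphereCard_mul_spherical_sq_le {t : ℝ} (ht : 1 ≤ t) (k : ℕ) :
    sphereCard t k * spherical t k ^ 2 ≤ 2 * ((k : ℝ) + 1) ^ 2 := by
  have ht0 : 0 < t := by linarith
  have ht2 : 1 ≤ t ^ 2 := one_le_pow₀ ht
  have h1 : sphereCard t k ≤ 2 * t ^ (2 * k) := by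
    unfold sphereCard
    split_ifs with hk
    · simp [hk]
    · rw [div_le_iff₀ (by positivity)]
      have : 0 < t ^ (2 * k) := by positivity
      nlinarith
  have h2 : 0 ≤ (t ^ 2 - 1) / (t ^ 2 + 1) := div_nonneg (by linarith) (by positivity)
  have h3 : (t ^ 2 - 1) / (t ^ 2 + 1) ≤ 1 := (div_le_one (by positivity)).2 (by linarith)
  calc sphereCard t k * spherical t k ^ 2
      ≤ 2 * t ^ (2 * k) * ((1 + 1 * k) / t ^ k) ^ 2 := by
        unfold spherical
        gcongr
    _ = 2 * ((k : ℝ) + 1) ^ 2 := by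
        rw [mul_comm 2 k, pow_mul, div_pow]
        field_simp
        ring

section Eigenvalues

variable {r : ℕ} {Γ : Type*} [Group Γ] (a : FreeGroupBasis (Fin r) Γ) {t : ℝ}

theorem sum_spherical_letter (ht : 1 ≤ t) (hr : 2 * (r : ℝ) = t ^ 2 + 1) (x : Γ) :
    ∑ p, spherical t (len a (x * letter a p)) = 2 * t * spherical t (len a x) := by
  have ht0 : t ≠ 0 := by linarith
  have ht2 : t ^ 2 + 1 ≠ 0 := by positivity
  by_cases hx : x = 1
  · subst hx
    simp only [one_mul]
    rw [sum_len_letter, Fintype.card_fin, hr, len_one]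
    simp only [spherical]
    push_cast
    field_simp
    ring
  · rw [sum_len_mul_letter a _ hx, Fintype.card_fin, hr]
    obtain ⟨k, hk⟩ := Nat.exists_eq_succ_of_ne_zero (fun h => hx ((len_eq_zero a).1 h))
    rw [hk]
    simp only [spherical, Nat.succ_eq_add_one, Nat.add_sub_cancel]
    push_cast
    field_simp
    ring

theorem card_wordSphere (ht : 1 ≤ t) (hr : 2 * (r : ℝ) = t ^ 2 + 1) (n : ℕ) :
    ((wordSphere (symmetricSet a) n).card : ℝ) = sphereCard t n := by
  have ht0 : t ≠ 0 := by linarith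
  have := sum_wordSphere_of_eigen a (f := fun _ => 1) (lam := t ^ 2 + 1) (P := sphereCard t)
    (by simp [← hr, mul_comm]) (by simp [sphereCard]) (by simp [sphereCard]; field_simp)
    (by rw [hr]; simp [sphereCard]; field_simp; ring)
    (by intro n; rw [hr]; simp [sphereCard]; field_simp; ring) 1 n
  simpa using this

theorem sum_wordSphere_spherical (ht : 1 ≤ t) (hr : 2 * (r : ℝ) = t ^ 2 + 1) (n : ℕ) (x : Γ) :
    ∑ g ∈ wordSphere (symmetricSet a) n, spherical t (len a (x * g)) =
      sphereCard t n * spherical t n * spherical t (len a x) := by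
  have ht0 : t ≠ 0 := by linarith
  have ht2 : t ^ 2 + 1 ≠ 0 := by positivity
  refine sum_wordSphere_of_eigen a (f := fun x => spherical t (len a x)) (lam := 2 * t)
    (P := fun n => sphereCard t n * spherical t n)
    (sum_spherical_letter a ht hr) ?_ ?_ ?_ ?_ x n
  · simp [sphereCard, spherical]
  · simp [sphereCard, spherical]
    field_simp
    ring
  · rw [hr]
    simp [sphereCard, spherical]
    field_simp
    ring
  · intro n
    rw [hr]
    simp [sphereCard, spherical]
    field_simp
    ring

theorem card_wordBall (ht : 1 ≤ t) (hr : 2 * (r : ℝ) = t ^ 2 + 1) (n : ℕ) :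
    ((wordBall (symmetricSet a) n).card : ℝ) =
      t ^ (2 * n) + 2 * ∑ k ∈ Finset.range n, t ^ (2 * k) := by
  have ht0 : t ≠ 0 := by linarith
  have hcard : ∀ s : Finset Γ, (s.card : ℝ) = ∑ g ∈ s, (1 : ℝ) := by simp
  rw [hcard]
  induction n with
  | zero => rw [sum_wordBall_zero]; simp
  | succ n ih =>
    rw [sum_wordBall_succ, ih, ← hcard, card_wordSphere a ht hr, Finset.sum_range_succ]
    simp [sphereCard]
    field_simp
    ring

theorem sum_wordBall_spherical (ht : 1 ≤ t) (hr : 2 * (r : ℝ) = t ^ 2 + 1) (n : ℕ) (x : Γ) :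
    ∑ g ∈ wordBall (symmetricSet a) n, spherical t (len a (x * g)) =
      t ^ n * (1 + (1 + 1 / t) * n) * spherical t (len a x) := by
  have ht0 : t ≠ 0 := by linarith
  have ht2 : t ^ 2 + 1 ≠ 0 := by positivity
  induction n with
  | zero =>
    rw [sum_wordBall_zero a (fun g => spherical t (len a (x * g)))]
    simp
  | succ n ih =>
    rw [sum_wordBall_succ a n (fun g => spherical t (len a (x * g))), ih,
      sum_wordSphere_spherical a ht hr, ← add_mul]
    congr 1
    simp [sphereCard, spherical]
    field_simp
    ring

theorem sum_wordBall_spherical_sq_le (ht : 1 ≤ t) (hr : 2 * (r : ℝ) = t ^ 2 + 1) (m : ℕ) :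
    ∑ x ∈ wordBall (symmetricSet a) m, spherical t (len a x) ^ 2 ≤ 2 * ((m : ℝ) + 1) ^ 3 := by
  rw [sum_wordBall_eq_sum]
  calc ∑ k ∈ Finset.range (m + 1), ∑ x ∈ wordSphere (symmetricSet a) k, spherical t (len a x) ^ 2
      = ∑ k ∈ Finset.range (m + 1), sphereCard t k * spherical t k ^ 2 := by
        refine Finset.sum_congr rfl fun k _ => ?_
        rw [← card_wordSphere a ht hr, ← nsmul_eq_mul]
        exact Finset.sum_eq_card_nsmul fun x hx => by rw [(mem_wordSphere a).1 hx]
    _ ≤ ∑ k ∈ Finset.range (m + 1), 2 * ((m : ℝ) + 1) ^ 2 := by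
        refine Finset.sum_le_sum fun k hk => (sphereCard_mul_spherical_sq_le ht k).trans ?_
        have : k ≤ m := by
          rw [Finset.mem_range] at hk
          omega
        gcongr
    _ = 2 * ((m : ℝ) + 1) ^ 3 := by
        rw [Finset.sum_const, Finset.card_range, nsmul_eq_mul]
        push_cast
        ring

/-- Although the spherical function is not square summable, its restrictions to balls are almost
eigenvectors because their norms grow polynomially; so the bound in the Schur test is attained. -/
theorem norm_extendRep_sum_eq (ht : 1 ≤ t) (hr : 2 * (r : ℝ) = t ^ 2 + 1) {E : Finset Γ} {n : ℕ}
    {Λ : ℝ} (hinv : ∀ γ ∈ E, γ⁻¹ ∈ E) (hlen : ∀ γ ∈ E, len a γ ≤ n)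
    (hΛ : ∀ x, ∑ γ ∈ E, spherical t (len a (x * γ)) = Λ * spherical t (len a x)) :
    ‖extendRep (rho Γ) (∑ γ ∈ E, MonoidAlgebra.of ℂ Γ γ)‖ = Λ := by
  refine le_antisymm (norm_extendRep_sum_le (φ := fun x => spherical t (len a x))
    (fun x => spherical_pos ht _) hinv hΛ) ?_
  -- compare squares: `Λ ^ 2` and `‖T‖ ^ 2` are the constants relating the norms of restrictions
  refine (le_abs_self _).trans (abs_le_of_sq_le_sq ?_ (norm_nonneg _))
  refine le_of_mul_le_mul_add_of_le_pow (n := n)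
    (u := fun m => ∑ x ∈ wordBall (symmetricSet a) m, spherical t (len a x) ^ 2)
    (sq_nonneg _) ?_ (sum_wordBall_spherical_sq_le a ht hr) fun m => ?_
  · rw [sum_wordBall_zero a (fun x => spherical t (len a x) ^ 2), len_one, spherical_zero]
    norm_num
  · refine sq_mul_sum_le_norm_sq_mul_sum (φ := fun x => spherical t (len a x)) hΛ
      fun x hx γ hγ => ?_
    rw [mem_wordBall] at hx ⊢
    exact (len_mul_le a x γ).trans (add_le_add hx (hlen γ hγ))

end Eigenvalues

end FreeGroupNorm

theorem mainTheorem5 {r : ℕ} (hr : 1 ≤ r) {Γ : Type*} [Group Γ] (a : FreeGroupBasis (Fin r) Γ)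
    (q : ℝ) (hq : q = 2 * (r : ℝ) - 1) (n : ℕ) :
    ‖FreeGroupNorm.extendRep (FreeGroupNorm.rho Γ)
        (FreeGroupNorm.mu (FreeGroupNorm.wordSphere (FreeGroupNorm.symmetricSet a) n))‖
      = (1 + (q - 1) / (q + 1) * (n : ℝ)) * q ^ (-(n : ℝ) / 2) ∧
    ‖FreeGroupNorm.extendRep (FreeGroupNorm.rho Γ)
        (FreeGroupNorm.mu (FreeGroupNorm.wordBall (FreeGroupNorm.symmetricSet a) n))‖
      = FreeGroupNorm.c q n * (1 + (1 + 1 / Real.sqrt q) * (n : ℝ)) * q ^ (-(n : ℝ) / 2) := by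
  open FreeGroupNorm in
  have hr' : (1 : ℝ) ≤ r := by exact_mod_cast hr
  have hq1 : 1 ≤ q := by linarith
  have ht : 1 ≤ Real.sqrt q := Real.one_le_sqrt.2 hq1
  have htq : Real.sqrt q ^ 2 = q := Real.sq_sqrt (by linarith)
  -- everything is expressed in terms of `t = √q`
  generalize Real.sqrt q = t at *
  subst htq
  have hrt : 2 * (r : ℝ) = t ^ 2 + 1 := by linarith
  have ht0 : 0 < t := by linarith
  have hpow : (t ^ 2) ^ (-(n : ℝ) / 2) = (t ^ n)⁻¹ := by
    rw [← Real.rpow_natCast t 2, ← Real.rpow_mul ht0.le, ← Real.rpow_natCast t n,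
      ← Real.rpow_neg ht0.le]
    congr 1
    push_cast
    ring
  rw [hpow, norm_extendRep_mu, norm_extendRep_mu]
  constructor
  · rw [norm_extendRep_sum_eq a ht hrt (n := n)
        (fun γ hγ => by rwa [mem_wordSphere, len_inv, ← mem_wordSphere])
        (fun γ hγ => ((mem_wordSphere a).1 hγ).le) (sum_wordSphere_spherical a ht hrt n),
      card_wordSphere a ht hrt]
    have : sphereCard t n ≠ 0 := by
      unfold sphereCard
      split_ifs <;> positivity
    rw [inv_mul_cancel_left₀ this, spherical, div_eq_mul_inv]
  · rw [norm_extendRep_sum_eq a ht hrt (n := n)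
        (fun γ hγ => by rwa [mem_wordBall, len_inv, ← mem_wordBall])
        (fun γ hγ => (mem_wordBall a).1 hγ) (sum_wordBall_spherical a ht hrt n),
      card_wordBall a ht hrt, c, zpow_neg, zpow_natCast]
    simp only [← pow_mul]
    have hS : 0 ≤ ∑ k ∈ Finset.range n, t ^ (2 * k) := Finset.sum_nonneg fun _ _ => by positivity
    generalize ∑ k ∈ Finset.range n, t ^ (2 * k) = S at *
    have h1 : t ^ (2 * n) + 2 * S ≠ 0 := by positivity
    have h2 : 1 + 2 * (t ^ (2 * n))⁻¹ * S = (t ^ (2 * n) + 2 * S) / (t ^ (2 * n)) := by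
      field_simp
    rw [h2, inv_div, mul_comm 2 n, pow_mul]
    rw [mul_comm 2 n, pow_mul] at h1
    field_simp
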